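/- For a positive integer $n$, a matching of $[2n]=\{1,2,\dots,2n\}$ is a partition of $[2n]$ into $n$ two-element sets, called edges, and the length of an edge $\{i,j\}$ with $i<j$ is $\ell(\{i,j\})=j-i$. Let $\mathbb{RM}(n)$ be a matching picked uniformly at random from the set of all matchings of $[2n]$, and let $$\bar L=\frac1n\sum_{e\in\mathbb{RM}(n)}\ell(e)$$ be its average edge length. Then $$\mathbb{E}\,\bar L=\frac{2n+1}{3}\qquad\text{for every } n\ge 1,$$ and, for every real-valued function $\omega$ on the positive integers with $\omega(n)\to\infty$ as $n\to\infty$, $$\lim_{n\to\infty}\mathbb{P}\left(\left|\bar L-\frac{2n}{3}\right|\le \omega(n)\sqrt n\right)=1 .$$ -/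

import Mathlib

open MeasureTheory ProbabilityTheory Filter Topology

/-- A matching of `[2n]`: a set of edges (unordered pairs of two distinct points) such that every
point lies on exactly one edge. The points `1, …, 2n` are represented, in their order, by the
elements `0, …, 2n - 1` of `Fin (2 * n)`; this shift does not change the differences of points. -/
def IsOrderedMatching {n : ℕ} (M : Finset (Sym2 (Fin (2 * n)))) : Prop :=
  (∀ e ∈ M, ¬ e.IsDiag) ∧ ∀ i : Fin (2 * n), ∃! e, e ∈ M ∧ i ∈ e

/-- The set of all matchings of `[2n]`, as a type. -/
def OrderedMatching (n : ℕ) : Type :=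
  {M : Finset (Sym2 (Fin (2 * n))) // IsOrderedMatching M}

namespace OrderedMatching

/-- The edges of a matching. -/
def edges {n : ℕ} (M : OrderedMatching n) : Finset (Sym2 (Fin (2 * n))) := M.1

instance (n : ℕ) : Finite (OrderedMatching n) := Subtype.finite

/-- Every set of matchings is an event. -/
instance (n : ℕ) : MeasurableSpace (OrderedMatching n) := ⊤

instance (n : ℕ) : DiscreteMeasurableSpace (OrderedMatching n) := ⟨fun _ => trivial⟩

/-- The matching that joins the `i`-th point from the left to the `i`-th point from the right. -/
instance (n : ℕ) : Nonempty (OrderedMatching n) := by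
  refine ⟨⟨Finset.univ.image fun i : Fin (2 * n) => s(i, i.rev), ?_, ?_⟩⟩
  · intro e he
    obtain ⟨i, -, rfl⟩ := Finset.mem_image.1 he
    rw [Sym2.mk_isDiag_iff, Fin.ext_iff, Fin.val_rev]
    omega
  · intro i
    refine ⟨s(i, i.rev), ⟨Finset.mem_image_of_mem _ (Finset.mem_univ i), Sym2.mem_mk_left _ _⟩, ?_⟩
    rintro e ⟨he, hi⟩
    obtain ⟨j, -, rfl⟩ := Finset.mem_image.1 he
    rcases Sym2.mem_iff.1 hi with rfl | rfl
    · rfl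
    · rw [Fin.rev_rev, Sym2.eq_swap]

end OrderedMatching

/-- The length `j - i` of the edge `{i, j}` with `i < j`. -/
def edgeLength {m : ℕ} (e : Sym2 (Fin m)) : ℝ :=
  (e.sup.val : ℝ) - (e.inf.val : ℝ)

/-- The total length `L` of the edges of a matching. -/
noncomputable def totalLength {n : ℕ} (M : OrderedMatching n) : ℝ :=
  ∑ e ∈ M.edges, edgeLength e

/-- The average edge length `L / n` of a matching of `[2n]`. -/
noncomputable def avgLength {n : ℕ} (M : OrderedMatching n) : ℝ :=
  totalLength M / n

/-- The law of the random matching of `[2n]`: the uniform distribution on all matchings. -/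
noncomputable def randomMatching (n : ℕ) : Measure (OrderedMatching n) :=
  uniformOn Set.univ

instance (n : ℕ) : IsProbabilityMeasure (randomMatching n) :=
  isProbabilityMeasure_uniformOn Set.finite_univ Set.univ_nonempty

/-! Twice the total length is the sum of `|i - j|` over ordered pairs, weighted by the indicator
that `i` and `j` are joined. Uniformity is invariant under relabelling, so a given edge occurs with
probability `1/(2n-1)` and two given disjoint edges occur together with probability
`1/((2n-1)(2n-3))`. With `sum_abs_sub` the first fact gives the mean.

In the second moment, distinct edges sharing a point contribute nothing, coinciding edges contribute
`O(n^3)`, and disjoint ones give nearly the squared mean. After division by `n^2` the mean square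
deviation of the average from `2n/3` is `O(n)` (`integral_sq_avgLength_sub_le`), and Chebyshev's
inequality finishes. -/

open scoped Classical in
noncomputable instance (n : ℕ) : Fintype (OrderedMatching n) := Fintype.ofFinite _

/-! ### Symmetry and joint edge counts -/

namespace OrderedMatching

variable {n : ℕ}

/-- Relabelling the points of a matching by a permutation. -/
def relabel (σ : Equiv.Perm (Fin (2 * n))) (M : OrderedMatching n) : OrderedMatching n :=
  ⟨Finset.univ.filter fun e => e.map σ ∈ M.edges, by
    constructor
    · intro e he hd
      refine M.2.1 _ (Finset.mem_filter.1 he).2 ?_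
      induction e with
      | _ a b =>
        rw [Sym2.mk_isDiag_iff] at hd
        simp [hd]
    · intro i
      obtain ⟨e, ⟨he, hi⟩, hu⟩ := M.2.2 (σ i)
      refine ⟨e.map σ.symm, ⟨?_, ?_⟩, ?_⟩
      · exact Finset.mem_filter.2 ⟨Finset.mem_univ _, by simpa [Sym2.map_map, edges] using he⟩
      · exact Sym2.mem_map.2 ⟨σ i, hi, by simp⟩
      · rintro f ⟨hf, hif⟩
        have := hu (f.map σ) ⟨(Finset.mem_filter.1 hf).2, Sym2.mem_map.2 ⟨i, hif, rfl⟩⟩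
        rw [← this]
        simp [Sym2.map_map]⟩

lemma mem_relabel {σ : Equiv.Perm (Fin (2 * n))} {M : OrderedMatching n}
    {e : Sym2 (Fin (2 * n))} : e ∈ (relabel σ M).edges ↔ e.map σ ∈ M.edges := by
  change e ∈ Finset.univ.filter _ ↔ _
  simp

lemma relabel_relabel_symm (σ : Equiv.Perm (Fin (2 * n))) (M : OrderedMatching n) :
    relabel σ (relabel σ.symm M) = M := by
  apply Subtype.ext
  ext e
  change e ∈ (relabel σ (relabel σ.symm M)).edges ↔ e ∈ M.edges
  simp [mem_relabel, Sym2.map_map]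

/-- Relabelling as a permutation of the set of all matchings. -/
def relabelEquiv (σ : Equiv.Perm (Fin (2 * n))) : OrderedMatching n ≃ OrderedMatching n where
  toFun := relabel σ
  invFun := relabel σ.symm
  left_inv M := relabel_relabel_symm σ.symm M
  right_inv M := relabel_relabel_symm σ M

/-- The indicator that `i` and `j` are joined by a matching. -/
def joined (M : OrderedMatching n) (i j : Fin (2 * n)) : ℝ :=
  if s(i, j) ∈ M.edges then 1 else 0

lemma joined_self (M : OrderedMatching n) (i : Fin (2 * n)) : joined M i i = 0 :=
  if_neg fun h => M.2.1 _ h (by simp)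

lemma joined_comm (M : OrderedMatching n) (i j : Fin (2 * n)) : joined M i j = joined M j i := by
  rw [joined, joined, Sym2.eq_swap]

lemma joined_mul_self (M : OrderedMatching n) (i j : Fin (2 * n)) :
    joined M i j * joined M i j = joined M i j := by
  unfold joined; split_ifs <;> norm_num

lemma joined_mul_joined_eq_zero (M : OrderedMatching n) {i j k : Fin (2 * n)} (h : j ≠ k) :
    joined M i j * joined M i k = 0 := by
  unfold joined
  split_ifs with h1 h2 <;> try simp
  have := (M.2.2 i).unique ⟨h1, Sym2.mem_mk_left _ _⟩ ⟨h2, Sym2.mem_mk_left _ _⟩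
  exact h (Sym2.congr_right.1 this)

lemma joined_relabel (σ : Equiv.Perm (Fin (2 * n))) (M : OrderedMatching n)
    (i j : Fin (2 * n)) : joined (relabel σ M) i j = joined M (σ i) (σ j) := by
  simp [joined, mem_relabel]

lemma sum_joined (M : OrderedMatching n) (i : Fin (2 * n)) : ∑ j, joined M i j = 1 := by
  obtain ⟨e, ⟨he, hi⟩, -⟩ := M.2.2 i
  obtain ⟨j, rfl⟩ := hi
  rw [Finset.sum_eq_single j]
  · exact if_pos he
  · intro k _ hk
    have := joined_mul_joined_eq_zero M (i := i) hk.symm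
    rwa [show joined M i j = 1 from if_pos he, one_mul] at this
  · simp

lemma sum_apply_relabel (σ : Equiv.Perm (Fin (2 * n))) (f : OrderedMatching n → ℝ) :
    ∑ M, f (relabel σ M) = ∑ M, f M :=
  Equiv.sum_comp (relabelEquiv σ) f

/-- The number of matchings that join two given points. -/
lemma sum_joined_matchings {i j : Fin (2 * n)} (hij : i ≠ j) :
    (2 * (n : ℝ) - 1) * ∑ M : OrderedMatching n, joined M i j =
      Fintype.card (OrderedMatching n) := by
  -- The transposition of `j` and `k` fixes `i`, so all `2n - 1` possible partners of `i` are
  -- equally frequent.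
  have hsymm : ∀ k, k ≠ i → ∑ M : OrderedMatching n, joined M i k = ∑ M, joined M i j := by
    intro k hk
    rw [← sum_apply_relabel (Equiv.swap j k)]
    refine Finset.sum_congr rfl fun M _ => ?_
    rw [joined_relabel, Equiv.swap_apply_right, Equiv.swap_apply_of_ne_of_ne hij hk.symm]
  have hsum : ∑ k, ∑ M : OrderedMatching n, joined M i k =
      Fintype.card (OrderedMatching n) := by
    rw [Finset.sum_comm]
    simp [sum_joined]
  have hn : 1 ≤ 2 * n := by have := i.2; omega
  rw [← Finset.sum_erase_add _ _ (Finset.mem_univ i)] at hsum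
  simp only [joined_self, Finset.sum_const_zero, add_zero] at hsum
  rw [Finset.sum_congr rfl fun k hk => hsymm k (Finset.ne_of_mem_erase hk), Finset.sum_const,
    Finset.card_erase_of_mem (Finset.mem_univ i), Finset.card_univ, Fintype.card_fin,
    nsmul_eq_mul, Nat.cast_sub hn] at hsum
  simpa using hsum

/-- The number of matchings that contain two given disjoint edges. -/
lemma sum_joined_mul_joined {i j k l : Fin (2 * n)} (hij : i ≠ j) (hik : i ≠ k) (hil : i ≠ l)
    (hjk : j ≠ k) (hjl : j ≠ l) (hkl : k ≠ l) :
    (2 * (n : ℝ) - 3) * ∑ M : OrderedMatching n, joined M i j * joined M k l =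
      ∑ M : OrderedMatching n, joined M i j := by
  have hsymm : ∀ m, m ∉ ({i, j, k} : Finset (Fin (2 * n))) →
      ∑ M : OrderedMatching n, joined M i j * joined M k m =
        ∑ M, joined M i j * joined M k l := by
    intro m hm
    have hmi : m ≠ i := fun h => hm (by simp [h])
    have hmj : m ≠ j := fun h => hm (by simp [h])
    have hmk : m ≠ k := fun h => hm (by simp [h])
    rw [← sum_apply_relabel (Equiv.swap l m)]
    refine Finset.sum_congr rfl fun M _ => ?_
    rw [joined_relabel, joined_relabel, Equiv.swap_apply_right,
      Equiv.swap_apply_of_ne_of_ne hil hmi.symm, Equiv.swap_apply_of_ne_of_ne hjl hmj.symm,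
      Equiv.swap_apply_of_ne_of_ne hkl hmk.symm]
  have hsum : ∑ m, ∑ M : OrderedMatching n, joined M i j * joined M k m =
      ∑ M : OrderedMatching n, joined M i j := by
    rw [Finset.sum_comm]
    simp [← Finset.mul_sum, sum_joined]
  -- Once `i` and `j` are joined, `k` has only the `2n - 3` points outside `{i, j, k}` as partners.
  have hzero : ∀ m ∈ ({i, j, k} : Finset (Fin (2 * n))),
      ∑ M : OrderedMatching n, joined M i j * joined M k m = 0 := by
    intro m hm
    refine Finset.sum_eq_zero fun M _ => ?_
    simp only [Finset.mem_insert, Finset.mem_singleton] at hm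
    rcases hm with rfl | rfl | rfl
    · rw [joined_comm M k, joined_mul_joined_eq_zero M hjk]
    · rw [joined_comm M k, joined_comm M i, joined_mul_joined_eq_zero M hik]
    · rw [joined_self, mul_zero]
  have hcard : ({i, j, k} : Finset (Fin (2 * n))).card = 3 :=
    Finset.card_eq_three.2 ⟨i, j, k, hij, hik, hjk, rfl⟩
  have hn : 3 ≤ 2 * n := by
    have := Finset.card_le_univ ({i, j, k} : Finset (Fin (2 * n)))
    rwa [hcard, Fintype.card_fin] at this
  rw [← Finset.sum_add_sum_compl {i, j, k}, Finset.sum_eq_zero hzero, zero_add,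
    Finset.sum_congr rfl fun m hm => hsymm m (Finset.mem_compl.1 hm), Finset.sum_const,
    Finset.card_compl, hcard, Fintype.card_fin, nsmul_eq_mul, Nat.cast_sub hn] at hsum
  simpa using hsum

/-- An upper bound for the number of matchings that contain two given edges. -/
lemma sum_joined_mul_joined_le (hn : 2 ≤ n) {i j k l : Fin (2 * n)} (hij : i ≠ j) (hkl : k ≠ l) :
    ∑ M : OrderedMatching n, joined M i j * joined M k l ≤
      Fintype.card (OrderedMatching n) / (2 * (n : ℝ) - 1) *
        (1 / (2 * (n : ℝ) - 3) + (if k = i ∧ l = j then 1 else 0) +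
          (if k = j ∧ l = i then 1 else 0)) := by
  have hn' : (2 : ℝ) ≤ n := by exact_mod_cast hn
  have h1 : (0 : ℝ) < 2 * n - 1 := by linarith
  have h3 : (0 : ℝ) < 2 * n - 3 := by linarith
  set c : ℝ := Fintype.card (OrderedMatching n) / (2 * (n : ℝ) - 1) with hc
  have hc0 : 0 ≤ c := by positivity
  have hcij : ∑ M : OrderedMatching n, joined M i j = c := by
    rw [hc, eq_div_iff h1.ne', mul_comm, sum_joined_matchings hij]
  have hq : 0 ≤ 1 / (2 * (n : ℝ) - 3) := by positivity
  -- Equal edges give `c`, edges sharing exactly one point give `0`, and disjoint edges give `c /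
  -- (2n - 3)`.
  by_cases hki : k = i
  · subst hki
    by_cases hlj : l = j
    · subst hlj
      simp only [joined_mul_self, hcij]
      simp only [and_self, if_true]
      exact le_mul_of_one_le_right hc0 (by split_ifs <;> linarith)
    · simp only [joined_mul_joined_eq_zero _ (Ne.symm hlj), Finset.sum_const_zero]
      positivity
  by_cases hkj : k = j
  · subst hkj
    by_cases hli : l = i
    · subst hli
      simp only [joined_comm _ k l, joined_mul_self, hcij, and_self, if_true]
      exact le_mul_of_one_le_right hc0 (by split_ifs <;> linarith)
    · simp only [joined_comm _ i k, joined_mul_joined_eq_zero _ (Ne.symm hli),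
        Finset.sum_const_zero]
      positivity
  by_cases hli : l = i
  · subst hli
    simp only [joined_comm _ k l, joined_mul_joined_eq_zero _ (Ne.symm hkj),
      Finset.sum_const_zero]
    positivity
  by_cases hlj : l = j
  · subst hlj
    simp only [joined_comm _ i l, joined_comm _ k l, joined_mul_joined_eq_zero _ (Ne.symm hki),
      Finset.sum_const_zero]
    positivity
  have := sum_joined_mul_joined hij (Ne.symm hki) (Ne.symm hli) (Ne.symm hkj) (Ne.symm hlj) hkl
  rw [if_neg (fun h => hki h.1), if_neg (fun h => hkj h.1), add_zero, add_zero, mul_one_div,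
    le_div_iff₀ h3, mul_comm, this, hcij]

/-- Twice the total length as a sum over ordered pairs of points. -/
lemma two_mul_totalLength (M : OrderedMatching n) :
    2 * totalLength M = ∑ i, ∑ j, |(i.val : ℝ) - j.val| * joined M i j := by
  have hlen : ∀ a b : Fin (2 * n), edgeLength s(a, b) = |(a.val : ℝ) - b.val| := by
    intro a b
    rcases le_total a b with h | h
    · have : (a.val : ℝ) ≤ b.val := by exact_mod_cast h
      rw [edgeLength, Sym2.sup_mk, Sym2.inf_mk, sup_eq_right.2 h, inf_eq_left.2 h,
        abs_of_nonpos (by linarith)]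
      ring
    · have : (b.val : ℝ) ≤ a.val := by exact_mod_cast h
      rw [edgeLength, Sym2.sup_mk, Sym2.inf_mk, sup_eq_left.2 h, inf_eq_right.2 h,
        abs_of_nonneg (by linarith)]
  -- Each edge comes from exactly two ordered pairs.
  have hfib : ∀ e ∈ M.edges,
      ∑ x : Fin (2 * n) × Fin (2 * n) with s(x.1, x.2) = e, edgeLength s(x.1, x.2) =
        2 * edgeLength e := by
    intro e he
    rw [Finset.sum_congr rfl fun x hx => by rw [(Finset.mem_filter.1 hx).2], Finset.sum_const,
      nsmul_eq_mul]
    congr 1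
    have hd := M.2.1 e he
    induction e with
    | _ a b =>
      rw [Sym2.mk_isDiag_iff] at hd
      have : (Finset.univ.filter fun x : Fin (2 * n) × Fin (2 * n) => s(x.1, x.2) = s(a, b)) =
          {(a, b), (b, a)} := by
        ext ⟨x, y⟩
        simp
      rw [this, Finset.card_pair (by simp [hd])]
      norm_num
  rw [totalLength, Finset.mul_sum, ← Finset.sum_congr rfl hfib, ← Finset.sum_product']
  simp only [joined, mul_ite, mul_one, mul_zero, ← hlen, Finset.univ_product_univ]
  rw [← Finset.sum_filter,
    ← Finset.sum_fiberwise_of_maps_to (t := M.edges) (g := fun x : Fin (2 * n) × Fin (2 * n) => s(x.1, x.2))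
      (fun x hx => (Finset.mem_filter.1 hx).2)]
  refine Finset.sum_congr rfl fun e he => Finset.sum_congr ?_ fun _ _ => rfl
  ext x
  simp only [Finset.mem_filter, Finset.mem_univ, true_and]
  exact ⟨fun h => ⟨h ▸ he, h⟩, fun h => h.2⟩

end OrderedMatching

/-- Passing from `N` to `N + 1` adds a row and a column, each of sum `N(N+1)/2`. -/
lemma sum_abs_sub (N : ℕ) :
    ∑ i : Fin N, ∑ j : Fin N, |(i.val : ℝ) - j.val| = (N - 1) * N * (N + 1) / 3 := by
  have hrow : ∀ N : ℕ, ∑ i ∈ Finset.range N, ((N : ℝ) - i) = N * (N + 1) / 2 := by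
    intro N
    induction N with
    | zero => simp
    | succ N ih =>
      have : ∑ i ∈ Finset.range N, (((N + 1 : ℕ) : ℝ) - i) =
          ∑ i ∈ Finset.range N, ((N : ℝ) - i) + N := by
        simp only [Finset.sum_sub_distrib, Finset.sum_const, Finset.card_range, nsmul_eq_mul]
        push_cast
        ring
      rw [Finset.sum_range_succ, this, ih]
      push_cast
      ring
  have hright : ∀ N : ℕ, ∑ i ∈ Finset.range N, |(i : ℝ) - N| = N * (N + 1) / 2 := by
    intro N
    rw [← hrow]
    refine Finset.sum_congr rfl fun i hi => ?_
    have : (i : ℝ) ≤ N := by exact_mod_cast (Finset.mem_range.1 hi).le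
    rw [abs_of_nonpos (by linarith)]
    ring
  have hleft : ∀ N : ℕ, ∑ i ∈ Finset.range N, |(N : ℝ) - i| = N * (N + 1) / 2 := by
    intro N
    simp only [← hright N, abs_sub_comm]
  have hin : ∀ i : Fin N, ∑ j : Fin N, |(i.val : ℝ) - j.val| =
      ∑ j ∈ Finset.range N, |(i.val : ℝ) - (j : ℝ)| := fun i =>
    Fin.sum_univ_eq_sum_range (fun j => |(i.val : ℝ) - (j : ℝ)|) N
  simp only [hin]
  rw [Fin.sum_univ_eq_sum_range (fun i => ∑ j ∈ Finset.range N, |(i : ℝ) - (j : ℝ)|) N]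
  clear hin
  induction N with
  | zero => simp
  | succ N ih =>
    simp only [Finset.sum_range_succ, Finset.sum_add_distrib]
    rw [ih, hright, hleft]
    push_cast
    simp
    ring

/-! ### First and second moments -/

open OrderedMatching

lemma integral_randomMatching {n : ℕ} (f : OrderedMatching n → ℝ) :
    ∫ M, f M ∂(randomMatching n) = (∑ M, f M) / Fintype.card (OrderedMatching n) := by
  have h : ∀ M : OrderedMatching n,
      (randomMatching n).real {M} = (Fintype.card (OrderedMatching n) : ℝ)⁻¹ := by
    intro M
    rw [Measure.real, randomMatching, uniformOn_univ, Measure.count_singleton]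
    simp
  rw [integral_fintype Integrable.of_finite]
  simp only [h, smul_eq_mul]
  rw [← Finset.mul_sum, inv_mul_eq_div]

lemma sum_two_mul_totalLength {n : ℕ} (hn : 1 ≤ n) :
    ∑ M : OrderedMatching n, 2 * totalLength M =
      Fintype.card (OrderedMatching n) * (2 * (n : ℝ) * (2 * n + 1) / 3) := by
  have hn' : (1 : ℝ) ≤ n := by exact_mod_cast hn
  have h1 : (2 * (n : ℝ) - 1) ≠ 0 := by linarith
  simp only [two_mul_totalLength]
  rw [Finset.sum_comm]
  have : ∀ i : Fin (2 * n), ∑ M : OrderedMatching n, ∑ j, |(i.val : ℝ) - j.val| * joined M i j =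
      ∑ j : Fin (2 * n), |(i.val : ℝ) - j.val| *
        (Fintype.card (OrderedMatching n) / (2 * (n : ℝ) - 1)) := by
    intro i
    rw [Finset.sum_comm]
    refine Finset.sum_congr rfl fun j _ => ?_
    rw [← Finset.mul_sum]
    by_cases hij : i = j
    · simp [hij]
    · rw [← sum_joined_matchings hij, mul_div_cancel_left₀ _ h1]
  simp only [this, ← Finset.sum_mul, sum_abs_sub]
  push_cast
  field_simp

lemma integral_avgLength {n : ℕ} (hn : 1 ≤ n) :
    ∫ M, avgLength M ∂(randomMatching n) = (2 * (n : ℝ) + 1) / 3 := by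
  have hn' : (n : ℝ) ≠ 0 := by positivity
  have hc : (Fintype.card (OrderedMatching n) : ℝ) ≠ 0 := by simp
  have h := sum_two_mul_totalLength hn
  rw [← Finset.mul_sum] at h
  have h' : ∑ M : OrderedMatching n, totalLength M =
      Fintype.card (OrderedMatching n) * (n * (2 * n + 1) / 3) := by linarith
  rw [integral_randomMatching]
  simp only [avgLength]
  rw [← Finset.sum_div, h']
  field_simp

lemma sum_sq_two_mul_totalLength_le {n : ℕ} (hn : 2 ≤ n) :
    ∑ M : OrderedMatching n, (2 * totalLength M) ^ 2 ≤
      Fintype.card (OrderedMatching n) / (2 * (n : ℝ) - 1) *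
        (((2 * (n : ℝ) - 1) * (2 * n) * (2 * n + 1) / 3) ^ 2 / (2 * (n : ℝ) - 3) +
          2 * (2 * n * ((2 * (n : ℝ) - 1) * (2 * n) * (2 * n + 1) / 3))) := by
  set w : Fin (2 * n) × Fin (2 * n) → ℝ := fun x => |(x.1.val : ℝ) - x.2.val| with hw
  have hw0 : ∀ x, 0 ≤ w x := fun x => abs_nonneg _
  have hwd : ∀ x, x.1 = x.2 → w x = 0 := fun x hx => by simp [hw, hx]
  have hwN : ∀ x, w x ≤ 2 * n := by
    intro x
    have h1 : (x.1.val : ℝ) ≤ 2 * n := by exact_mod_cast x.1.2.le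
    have h2 : (x.2.val : ℝ) ≤ 2 * n := by exact_mod_cast x.2.2.le
    exact abs_le.2 ⟨by linarith [Nat.cast_nonneg (α := ℝ) x.1.val],
      by linarith [Nat.cast_nonneg (α := ℝ) x.2.val]⟩
  have hT : ∑ x, w x = (2 * (n : ℝ) - 1) * (2 * n) * (2 * n + 1) / 3 := by
    have := sum_abs_sub (2 * n)
    push_cast at this
    rw [← this, Fintype.sum_prod_type]
  have hX : ∀ M : OrderedMatching n, (2 * totalLength M) ^ 2 =
      ∑ x, ∑ y, w x * w y * (joined M x.1 x.2 * joined M y.1 y.2) := by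
    intro M
    rw [two_mul_totalLength, ← Fintype.sum_prod_type' (f := fun i j : Fin (2 * n) =>
      |(i.val : ℝ) - j.val| * joined M i j), sq, Finset.sum_mul_sum]
    refine Finset.sum_congr rfl fun x _ => Finset.sum_congr rfl fun y _ => ?_
    simp only [hw]
    ring
  have hn' : (2 : ℝ) ≤ n := by exact_mod_cast hn
  have h1 : (0 : ℝ) < 2 * n - 1 := by linarith
  set c : ℝ := Fintype.card (OrderedMatching n) / (2 * (n : ℝ) - 1) with hc
  have hc0 : 0 ≤ c := by positivity
  have hpair : ∀ x y, ∑ M : OrderedMatching n,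
      w x * w y * (joined M x.1 x.2 * joined M y.1 y.2) ≤
        c * (w x * w y * (1 / (2 * (n : ℝ) - 3)) + (if y = x then w x * w y else 0) +
          (if y = x.swap then w x * w y else 0)) := by
    intro x y
    rw [← Finset.mul_sum]
    -- Diagonal pairs have weight zero, so the count is needed only for genuine edges.
    by_cases hx : x.1 = x.2
    · simp [hwd x hx]
    by_cases hy : y.1 = y.2
    · simp [hwd y hy]
    refine (mul_le_mul_of_nonneg_left (sum_joined_mul_joined_le hn hx hy)
      (mul_nonneg (hw0 x) (hw0 y))).trans (le_of_eq ?_)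
    simp only [Prod.ext_iff, Prod.fst_swap, Prod.snd_swap, ← hc]
    split_ifs <;> ring
  -- This crude bound on the coinciding edges already has the right order `n^4` before
  -- multiplication by `c`.
  have hsq : ∑ x, w x * w x ≤ 2 * n * ∑ x, w x := by
    rw [Finset.mul_sum]
    exact Finset.sum_le_sum fun x _ => mul_le_mul_of_nonneg_right (hwN x) (hw0 x)
  have hswap : ∀ x, w x.swap = w x := fun x => abs_sub_comm _ _
  calc ∑ M : OrderedMatching n, (2 * totalLength M) ^ 2
      = ∑ x, ∑ y, ∑ M : OrderedMatching n,
          w x * w y * (joined M x.1 x.2 * joined M y.1 y.2) := by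
        simp only [hX]
        rw [Finset.sum_comm]
        exact Finset.sum_congr rfl fun x _ => Finset.sum_comm
    _ ≤ ∑ x, ∑ y, c * (w x * w y * (1 / (2 * (n : ℝ) - 3)) +
          (if y = x then w x * w y else 0) + (if y = x.swap then w x * w y else 0)) :=
        Finset.sum_le_sum fun x _ => Finset.sum_le_sum fun y _ => hpair x y
    _ = c * ((∑ x, w x) ^ 2 / (2 * (n : ℝ) - 3) + 2 * ∑ x, w x * w x) := by
        simp only [← Finset.mul_sum, Finset.sum_add_distrib, Finset.sum_ite_eq',
          Finset.mem_univ, if_true, hswap]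
        rw [sq, Finset.sum_mul_sum]
        simp only [← Finset.mul_sum, ← Finset.sum_mul]
        ring
    _ ≤ _ := by
        rw [← hT]
        gcongr

lemma integral_sq_avgLength_sub_le {n : ℕ} (hn : 2 ≤ n) :
    ∫ M, (avgLength M - 2 * (n : ℝ) / 3) ^ 2 ∂(randomMatching n) ≤ 10 * (n : ℝ) := by
  have hn' : (2 : ℝ) ≤ n := by exact_mod_cast hn
  have h1 : (0 : ℝ) < 2 * n - 1 := by linarith
  have h3 : (0 : ℝ) < 2 * n - 3 := by linarith
  have hn0 : (0 : ℝ) < n := by linarith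
  have hc : (0 : ℝ) < Fintype.card (OrderedMatching n) := by
    exact_mod_cast Fintype.card_pos
  have hS1 := sum_two_mul_totalLength (show 1 ≤ n by omega)
  have hS2 := sum_sq_two_mul_totalLength_le hn
  have hexp : ∀ M : OrderedMatching n, (avgLength M - 2 * (n : ℝ) / 3) ^ 2 =
      (2 * totalLength M) ^ 2 * (1 / (4 * n ^ 2)) - 2 * totalLength M * (2 / 3) +
        4 * n ^ 2 / 9 := by
    intro M
    rw [avgLength]
    field_simp
    ring
  rw [integral_randomMatching, div_le_iff₀ hc]
  simp only [hexp, Finset.sum_add_distrib, Finset.sum_sub_distrib, ← Finset.sum_mul]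
  rw [hS1, Finset.sum_const, Finset.card_univ, nsmul_eq_mul]
  -- The constant `5` is sharp at `n = 2`; it cancels one factor `2n + 1` below.
  have hfac : 1 / (2 * (n : ℝ) - 3) ≤ 5 / (2 * n + 1) := by
    rw [div_le_div_iff₀ h3 (by linarith)]
    linarith
  have hmul := mul_le_mul_of_nonneg_right hS2
    (show (0 : ℝ) ≤ 1 / (4 * n ^ 2) by positivity)
  have hsimp : Fintype.card (OrderedMatching n) / (2 * (n : ℝ) - 1) *
        (((2 * (n : ℝ) - 1) * (2 * n) * (2 * n + 1) / 3) ^ 2 / (2 * (n : ℝ) - 3) +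
          2 * (2 * n * ((2 * (n : ℝ) - 1) * (2 * n) * (2 * n + 1) / 3))) * (1 / (4 * n ^ 2)) =
      Fintype.card (OrderedMatching n) * ((2 * (n : ℝ) + 1) ^ 2 / 9 +
        2 * (2 * (n : ℝ) + 1) ^ 2 / 9 * (1 / (2 * (n : ℝ) - 3)) + 2 * (2 * n + 1) / 3) := by
    field_simp
    ring
  have hlast : 2 * (2 * (n : ℝ) + 1) ^ 2 / 9 * (1 / (2 * (n : ℝ) - 3)) ≤
      10 * (2 * n + 1) / 9 := by
    calc _ ≤ 2 * (2 * (n : ℝ) + 1) ^ 2 / 9 * (5 / (2 * n + 1)) := by gcongr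
      _ = _ := by field_simp; ring
  -- The quadratic terms cancel, leaving at most `(32n + 17)/9`, so `10n` is generous.
  have hfin : (2 * (n : ℝ) + 1) ^ 2 / 9 +
        2 * (2 * (n : ℝ) + 1) ^ 2 / 9 * (1 / (2 * (n : ℝ) - 3)) + 2 * (2 * n + 1) / 3 -
        2 * (n : ℝ) * (2 * n + 1) / 3 * (2 / 3) + 4 * n ^ 2 / 9 ≤ 10 * n := by
    nlinarith
  rw [hsimp] at hmul
  have := mul_le_mul_of_nonneg_left hfin hc.le
  linarith

/-! ### Concentration by Chebyshev's inequality -/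

lemma le_measureReal_avgLength_deviation {n : ℕ} (hn : 2 ≤ n) {t : ℝ} (ht : 0 < t) :
    1 - 10 / t ^ 2 ≤ (randomMatching n).real
      {M : OrderedMatching n | |avgLength M - 2 * (n : ℝ) / 3| ≤ t * Real.sqrt n} := by
  have hn0 : (0 : ℝ) < n := by positivity
  set A := {M : OrderedMatching n | |avgLength M - 2 * (n : ℝ) / 3| ≤ t * Real.sqrt n} with hA
  have hcheb := mul_meas_ge_le_integral_of_nonneg (μ := randomMatching n)
    (f := fun M => (avgLength M - 2 * (n : ℝ) / 3) ^ 2)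
    (Eventually.of_forall fun M => sq_nonneg _) Integrable.of_finite (t ^ 2 * n)
  have hsub : (randomMatching n).real Aᶜ ≤
      (randomMatching n).real {M | t ^ 2 * n ≤ (avgLength M - 2 * (n : ℝ) / 3) ^ 2} := by
    refine measureReal_mono fun M hM => ?_
    have hM' : t * Real.sqrt n ≤ |avgLength M - 2 * (n : ℝ) / 3| := (lt_of_not_ge (Set.notMem_of_mem_compl hM)).le
    have := pow_le_pow_left₀ (by positivity) hM' 2
    rwa [mul_pow, Real.sq_sqrt hn0.le, sq_abs] at this
  have hcompl := probReal_compl_eq_one_sub (μ := randomMatching n)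
    (MeasurableSet.of_discrete (s := A))
  have hle : (randomMatching n).real Aᶜ ≤ 10 / t ^ 2 := by
    rw [le_div_iff₀ (by positivity)]
    have := (mul_le_mul_of_nonneg_left hsub (show 0 ≤ t ^ 2 * (n : ℝ) by positivity)).trans
      (hcheb.trans (integral_sq_avgLength_sub_le hn))
    nlinarith
  linarith

theorem mainTheorem6 :
    (∀ n : ℕ, 1 ≤ n →
      ∫ M, avgLength M ∂(randomMatching n) = (2 * (n : ℝ) + 1) / 3) ∧
    (∀ ω : ℕ → ℝ, Tendsto ω atTop atTop →
      Tendsto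
        (fun n : ℕ => randomMatching n
          {M : OrderedMatching n | |avgLength M - 2 * (n : ℝ) / 3| ≤ ω n * Real.sqrt n})
        atTop (𝓝 1)) := by
  refine ⟨fun n hn => integral_avgLength hn, fun ω hω => ?_⟩
  rw [← ENNReal.tendsto_toReal_iff (fun n => measure_ne_top _ _) ENNReal.one_ne_top,
    ENNReal.toReal_one]
  have hlow : Tendsto (fun n => 1 - 10 / ω n ^ 2) atTop (𝓝 1) := by
    have h := ((tendsto_pow_atTop two_ne_zero).comp hω).const_div_atTop (10 : ℝ)
    simpa using h.const_sub 1
  refine tendsto_of_tendsto_of_tendsto_of_le_of_le' hlow tendsto_const_nhds ?_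
    (Eventually.of_forall fun n => measureReal_le_one)
  -- The tail bound needs `ω n > 0` and `n ≥ 2`, which hold only eventually.
  filter_upwards [hω.eventually_gt_atTop 0, eventually_ge_atTop 2] with n h1 h2
  exact le_measureReal_avgLength_deviation h2 h1
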